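/- **Theorem (Coercivity).** Let $d\ge 1$ (in particular $d\in\{1,2,3\}$) and $p\ge 0$. A mesh $\mathcal T_h$ of a domain in $\mathbb R^d$ consists of finitely many convex polytopes $K$ with nonempty, pairwise disjoint interiors. $\Gamma_i$ is the set of its interior intersections $e=K_e^-\cap K_e^+$, i.e. intersections of two distinct cells that have positive $(d-1)$-dimensional measure $|e|$; $\mathbf n$ is a unit normal of $e$ (the orientation is immaterial below), and $$h_e=\frac{2|K_e^+||K_e^-|}{|e|(|K_e^-|+|K_e^+|)} .$$ Let $V_h^p$ be the space of functions whose restriction to each cell is a polynomial of total degree at most $p$. On $e\in\Gamma_i$ write $$[\![v]\!]=v^- - v^+,\qquad \{v\}=\tfrac12(v^-+v^+),\qquad \{\!\{w\}\!\}=\frac{2w^+w^-}{w^++w^-},$$ with $\{\!\{w\}\!\}:=0$ if $w^+=w^-=0$. Let $M(s)=\max\{1-s^2,0\}$. For $\varphi_h\in V_h^p$ let $M_h=M(\Pi^0\varphi_h)$ be the piecewise constant function with value $M(\overline{\varphi}_K)$ on $K$, where $\overline{\varphi}_K=|K|^{-1}\int_K\varphi_h\,dx$. For penalty parameters $\eta_e>0$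 define the SWIP form $$b(M_h,u,v)=\sum_{K}\int_{K} M_h\nabla u\cdot\nabla v\,dx+\sum_{e\in\Gamma_i}\int_e\{\!\{M_h\}\!\}\Big(\frac{\eta_e}{h_e}[\![u]\!][\![v]\!]-\{\nabla u\cdot\mathbf n\}[\![v]\!]-\{\nabla v\cdot\mathbf n\}[\![u]\!]\Big)ds$$ and the mobility-weighted DG seminorm $$\|v\|_{DG}^2=\sum_K\big\|\sqrt{M_h}\,\nabla v\big\|_{L^2(K)}^2+\sum_{e\in\Gamma_i}\int_e\frac{\{\!\{M_h\}\!\}}{h_e}[\![v]\!]^2\,ds .$$ Let $\tilde{\mathcal T}_h=\{K: M(\overline\varphi_K)>0\}$, and let $\tilde V_h^p$ be the space of functions whose restriction to each $K\in\tilde{\mathcal T}_h$ is a polynomial of total degree at most $p$; their values on the other cells do not enter $b(M_h,\cdot,\cdot)$ or $\|\cdot\|_{DG}$. 1. For every mesh and every $p$ there are $\eta_0>0$ and $\tilde C>0$, depending only on the mesh and on $p$ and not on the mobility, such that whenever $\eta_e\ge\eta_0$ for all $e\in\Gamma_i$, $$b(M_h,v,v)\ \ge\ \tilde C\,\|v\|_{DG}^2\qquad\text{for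 all }\varphi_h\in V_h^p,\ v\in\tilde V_h^p .$$ 2. Suppose moreover that the mesh is conforming and simplicial, i.e. every cell is a nondegenerate simplex and every $e\in\Gamma_i$ is a whole facet of both adjacent cells. Let $m_K$ be the number of $e\in\Gamma_i$ on the boundary of $K$, and let $$C_T=\frac{p(p+d-1)}{d}.$$ Then the same inequality holds, for all $\varphi_h\in V_h^p$ and $v\in\tilde V_h^p$, as soon as $\eta_e>0$ and $\eta_e\ge m_K C_T$ for all $e\in\Gamma_i$ and both cells $K\in\{K_e^-,K_e^+\}$. Here $\tilde C>0$ can be chosen depending only on $d$, $p$, a bound $\sigma$ for the ratio of the volumes of two cells that share an interior facet, and a positive lower bound for the $\eta_e$; it does not depend on the mobility. (If $\tilde{\mathcal T}_h=\emptyset$, i.e. $|\overline\varphi_K|\ge 1$ for all $K$, both sides are zero.) -/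

import Mathlib

open scoped MeasureTheory

noncomputable section

/-- A mesh of `ℝ^d`: finitely many closed convex polytopes `K_0, …, K_{N-1}` with nonempty
interior, whose interiors are pairwise disjoint. The meshed domain is their union. Hanging nodes are
allowed. -/
structure PolyMesh (d : ℕ) where
  numCells : ℕ
  cell : Fin numCells → Set (EuclideanSpace ℝ (Fin d))
  isPolytope : ∀ i, ∃ V : Set (EuclideanSpace ℝ (Fin d)), V.Finite ∧ cell i = convexHull ℝ V
  interior_nonempty : ∀ i, (interior (cell i)).Nonempty
  interior_disjoint : ∀ i j, i ≠ j → Disjoint (interior (cell i)) (interior (cell j))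

namespace PolyMesh

variable {d : ℕ} (T : PolyMesh d)

/-- The volume `|K|` of a cell. -/
def cellVol (i : Fin T.numCells) : ℝ :=
  MeasureTheory.volume.real (T.cell i)

/-- The intersection `e = K⁻ ∩ K⁺` of the cells `K⁻ = K_i` and `K⁺ = K_j`, for `e = (i, j)`. -/
def face (e : Fin T.numCells × Fin T.numCells) : Set (EuclideanSpace ℝ (Fin d)) :=
  T.cell e.1 ∩ T.cell e.2

/-- The `(d-1)`-dimensional surface measure, normalized to agree with Lebesgue measure on
hyperplanes (the counting measure if `d = 1`). -/
def surf (d : ℕ) : MeasureTheory.Measure (EuclideanSpace ℝ (Fin d)) :=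
  μHE[d - 1]

/-- The surface measure `|e|` of an intersection. -/
def faceVol (e : Fin T.numCells × Fin T.numCells) : ℝ :=
  (surf d).real (T.face e)

open Classical in
/-- The set `Γ_i` of interior intersections: all pairs of distinct cells that meet in a set of
positive surface measure, every pair being listed once, with `K⁻` the cell of smaller index. -/
def interiorFaces : Finset (Fin T.numCells × Fin T.numCells) :=
  Finset.univ.filter fun e => e.1 < e.2 ∧ 0 < T.faceVol e

open Classical in
/-- The number `m_K` of interior intersections on the boundary of a cell. -/
def numFaces (i : Fin T.numCells) : ℕ :=
  (T.interiorFaces.filter fun e => e.1 = i ∨ e.2 = i).card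

/-- `h_e = 2 |K⁺| |K⁻| / (|e| (|K⁻| + |K⁺|))`. -/
def faceSize (e : Fin T.numCells × Fin T.numCells) : ℝ :=
  2 * T.cellVol e.2 * T.cellVol e.1 / (T.faceVol e * (T.cellVol e.1 + T.cellVol e.2))

/-- `ν` assigns to every interior intersection one of its two unit normals. The orientation is
left free, so that every sign convention is covered (the consistent one for the jump `φ⁻ - φ⁺` is
from `K⁻` to `K⁺`). -/
def IsUnitNormal (ν : Fin T.numCells × Fin T.numCells → EuclideanSpace ℝ (Fin d)) : Prop :=
  ∀ e ∈ T.interiorFaces, ‖ν e‖ = 1 ∧ ∀ x ∈ T.face e, ∀ y ∈ T.face e, inner ℝ (ν e) (x - y) = 0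

/-- Every cell is a nondegenerate simplex, and every interior intersection is a whole facet of both
adjacent simplices (no hanging nodes). -/
def IsConformingSimplicial : Prop :=
  ∀ i, ∃ P : Fin (d + 1) → EuclideanSpace ℝ (Fin d), AffineIndependent ℝ P ∧
    T.cell i = convexHull ℝ (Set.range P) ∧
    ∀ e ∈ T.interiorFaces, (e.1 = i ∨ e.2 = i) → ∃ k, T.face e = convexHull ℝ (P '' {k}ᶜ)

/-- Broken polynomials of degree at most `p` over the set `S` of cells, as families of one polynomial
for each cell (the restriction of the function to that cell). The entries at cells outside `S`
are irrelevant and unconstrained. -/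
def BrokenPoly (p : ℕ) (S : Set (Fin T.numCells)) :
    Set (Fin T.numCells → MvPolynomial (Fin d) ℝ) :=
  {v | ∀ i ∈ S, (v i).totalDegree ≤ p}

/-- Value of a polynomial at a point of Euclidean space. -/
def val (q : MvPolynomial (Fin d) ℝ) (x : EuclideanSpace ℝ (Fin d)) : ℝ :=
  MvPolynomial.eval (fun k => x k) q

/-- Gradient of a polynomial at a point of Euclidean space. -/
def grad (q : MvPolynomial (Fin d) ℝ) (x : EuclideanSpace ℝ (Fin d)) : EuclideanSpace ℝ (Fin d) :=
  WithLp.toLp 2 fun k => val (MvPolynomial.pderiv k q) x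

/-- The cell average of a broken polynomial. -/
def cellAvg (φ : Fin T.numCells → MvPolynomial (Fin d) ℝ) (i : Fin T.numCells) : ℝ :=
  (T.cellVol i)⁻¹ * ∫ x in T.cell i, val (φ i) x

/-- The degenerate mobility `M(s) = max {1 - s², 0}`. -/
def mobility (s : ℝ) : ℝ :=
  max (1 - s ^ 2) 0

/-- The piecewise constant mobility `M(Π⁰ φ)`, given by its values on the cells. -/
def cellMobility (φ : Fin T.numCells → MvPolynomial (Fin d) ℝ) (i : Fin T.numCells) : ℝ :=
  mobility (T.cellAvg φ i)

/-- The set of cells on which the mobility is positive. -/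
def activeCells (φ : Fin T.numCells → MvPolynomial (Fin d) ℝ) : Set (Fin T.numCells) :=
  {i | 0 < T.cellMobility φ i}

/-- The harmonic mean of the values on both sides of `e`. If both values are `0`, the
quotient `0 / 0` is `0` here, which is the continuous extension. -/
def harm (w : Fin T.numCells → ℝ) (e : Fin T.numCells × Fin T.numCells) : ℝ :=
  2 * w e.2 * w e.1 / (w e.2 + w e.1)

/-- The jump `v⁻ - v⁺`. -/
def jump (v : Fin T.numCells → MvPolynomial (Fin d) ℝ) (e : Fin T.numCells × Fin T.numCells)
    (x : EuclideanSpace ℝ (Fin d)) : ℝ :=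
  val (v e.1) x - val (v e.2) x

/-- The arithmetic average of the normal derivatives from both sides. -/
def avgNormalDeriv (n : EuclideanSpace ℝ (Fin d)) (v : Fin T.numCells → MvPolynomial (Fin d) ℝ)
    (e : Fin T.numCells × Fin T.numCells) (x : EuclideanSpace ℝ (Fin d)) : ℝ :=
  (inner ℝ (grad (v e.1) x) n + inner ℝ (grad (v e.2) x) n) / 2

/-- The SWIP trilinear form `b(w, u, v)` for a piecewise constant mobility `w`, with unit normals `ν`
and penalty parameters `η`. -/
def swip (ν : Fin T.numCells × Fin T.numCells → EuclideanSpace ℝ (Fin d))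
    (η : Fin T.numCells × Fin T.numCells → ℝ) (w : Fin T.numCells → ℝ)
    (u v : Fin T.numCells → MvPolynomial (Fin d) ℝ) : ℝ :=
  (∑ i, ∫ x in T.cell i, w i * inner ℝ (grad (u i) x) (grad (v i) x)) +
    ∑ e ∈ T.interiorFaces, ∫ x in T.face e,
      T.harm w e * (η e / T.faceSize e * T.jump u e x * T.jump v e x
        - T.avgNormalDeriv (ν e) u e x * T.jump v e x
        - T.avgNormalDeriv (ν e) v e x * T.jump u e x) ∂surf d

/-- The square of the mobility-weighted DG seminorm. -/
def dgSeminormSq (w : Fin T.numCells → ℝ) (v : Fin T.numCells → MvPolynomial (Fin d) ℝ) : ℝ :=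
  (∑ i, ∫ x in T.cell i, ‖Real.sqrt (w i) • grad (v i) x‖ ^ 2) +
    ∑ e ∈ T.interiorFaces, ∫ x in T.face e, T.harm w e / T.faceSize e * T.jump v e x ^ 2 ∂surf d

end PolyMesh

/-- The constant `C_T = p (p + d - 1) / d` of the inverse trace inequality on simplices. -/
def traceConst (d p : ℕ) : ℝ :=
  (p : ℝ) * ((p : ℝ) + (d : ℝ) - 1) / (d : ℝ)

end

/-! ### One-variable endpoint inequality with weight `s ^ m`. -/

noncomputable section

namespace EndpointInequality

open Polynomial

/-! Take `u = v`. On a face with penalty `η`, Young's inequality with a parameter `s < η` bounds the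
consistency term `2 A j` (`A` the averaged normal derivative, `j` the jump) by `(s / h) j² + (h / s)
A²`. The first part is absorbed by the penalty. For the second, the harmonic mean is decisive:
`harm_mul_sq_le` splits the weighted square of `A` into one-sided squares, each carrying only the
mobility of its own cell. An inverse trace inequality on that cell then bounds it by the volume term
with the same mobility, so no mobility ratio enters the constants. If a neighbouring mobility
vanishes, so does the face term. `swip_ge_of_trace` reduces coercivity to a budget: per cell, the
absorbed trace constants must sum to less than one.

On a general mesh the trace constant comes from finite dimensionality, applied to gradients in `L²`;
a large penalty then meets the budget.

On simplices the constant must be explicit. A simplex is a cone over its facet, and a normal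
derivative restricted to a ray from the apex is a polynomial of degree below `p`. Integrating the
sharp endpoint bound `eval_one_sq_le` over the rays gives the factor `C_T |e| / |K|`. Multiplied by
`h_e` it becomes `2 C_T |K'| / (|K| + |K'|)`, where `K'` is the neighbour. The volume fraction is at
most `σ / (σ + 1) < 1`, and this strict gap leaves a positive coercivity constant even at `η_e = m_K
C_T`. -/

/-- Integral over `[0, 1]` against the weight `s ^ m`, as a linear functional on polynomials. -/
def weightedIntegral (m : ℕ) : ℝ[X] →ₗ[ℝ] ℝ where
  toFun f := ∫ s in (0 : ℝ)..1, s ^ m * f.eval s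
  map_add' f g := by
    rw [← intervalIntegral.integral_add (Continuous.intervalIntegrable (by fun_prop) _ _)
      (Continuous.intervalIntegrable (by fun_prop) _ _)]
    simp [mul_add]
  map_smul' c f := by
    simp only [eval_smul, smul_eq_mul, RingHom.id_apply]
    rw [← intervalIntegral.integral_const_mul]
    congr 1; ext s; ring

theorem weightedIntegral_apply (m : ℕ) (f : ℝ[X]) :
    weightedIntegral m f = ∫ s in (0 : ℝ)..1, s ^ m * f.eval s := rfl

theorem weightedIntegral_mul_self_nonneg (m : ℕ) (f : ℝ[X]) : 0 ≤ weightedIntegral m (f * f) := by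
  rw [weightedIntegral_apply]
  refine intervalIntegral.integral_nonneg zero_le_one fun s hs => ?_
  rw [eval_mul]
  exact mul_nonneg (pow_nonneg hs.1 _) (mul_self_nonneg _)

theorem eq_zero_of_weightedIntegral_mul_self {m : ℕ} {f : ℝ[X]}
    (h : weightedIntegral m (f * f) = 0) : f = 0 := by
  by_contra hf
  have hX : (X ^ m * (f * f) : ℝ[X]) ≠ 0 := by simp [hf]
  obtain ⟨c, hc, hc0⟩ : ∃ c ∈ Set.Icc (0 : ℝ) 1, (X ^ m * (f * f) : ℝ[X]).eval c ≠ 0 := by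
    by_contra! hall
    exact hX (eq_zero_of_infinite_isRoot _ ((Set.Icc_infinite zero_lt_one).mono hall))
  have hnn : ∀ s ∈ Set.Icc (0 : ℝ) 1, 0 ≤ s ^ m * (f * f).eval s := fun s hs => by
    rw [eval_mul]
    exact mul_nonneg (pow_nonneg hs.1 _) (mul_self_nonneg _)
  refine (intervalIntegral.integral_pos zero_lt_one (by fun_prop)
    (fun s hs => hnn s (Set.Ioc_subset_Icc_self hs)) ⟨c, hc, lt_of_le_of_ne (hnn c hc) ?_⟩).ne' h
  simpa using hc0.symm

/-- The integrand is the derivative of `s ^ (m + 1) * P`, which vanishes at `0`. -/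
theorem weightedIntegral_deriv (m : ℕ) (P : ℝ[X]) :
    weightedIntegral m (((m : ℝ) + 1) • P + X * derivative P) = P.eval 1 := by
  have key : ∀ s : ℝ, HasDerivAt (fun s => s ^ (m + 1) * P.eval s)
      (s ^ m * (((m : ℝ) + 1) • P + X * derivative P).eval s) s := fun s => by
    refine ((hasDerivAt_pow (m + 1) s).mul (P.hasDerivAt s)).congr_deriv ?_
    simp only [Nat.cast_add, Nat.cast_one, Nat.add_sub_cancel, eval_add, eval_smul, eval_mul,
      eval_X, smul_eq_mul]
    ring
  rw [weightedIntegral_apply, intervalIntegral.integral_eq_sub_of_hasDerivAt (fun s _ => key s)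
    (Continuous.intervalIntegrable (by fun_prop) _ _)]
  simp

/-- There is a nonzero polynomial of degree `n` orthogonal to all polynomials of smaller degree. -/
theorem exists_orthogonal (m n : ℕ) :
    ∃ P : ℝ[X], P.degree = n ∧ ∀ f ∈ degreeLT ℝ n, weightedIntegral m (P * f) = 0 := by
  let B : degreeLT ℝ (n + 1) →ₗ[ℝ] Module.Dual ℝ (degreeLT ℝ n) :=
    LinearMap.mk₂ ℝ (fun P f => weightedIntegral m (P.1 * f.1))
      (fun a b c => by simp [add_mul]) (fun a b c => by simp)
      (fun a b c => by simp [mul_add]) (fun a b c => by simp)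
  have hfin : ∀ k, Module.finrank ℝ (degreeLT ℝ k) = k := fun k => by
    rw [(degreeLTEquiv ℝ k).finrank_eq]; simp
  have : ∀ k, Module.Finite ℝ (degreeLT ℝ k) := fun k =>
    Module.Finite.equiv (degreeLTEquiv ℝ k).symm
  have hker : LinearMap.ker B ≠ ⊥ := by
    apply LinearMap.ker_ne_bot_of_finrank_lt
    rw [Subspace.dual_finrank_eq, hfin, hfin]
    exact Nat.lt_succ_self n
  obtain ⟨P, hP, hP0⟩ := Submodule.exists_mem_ne_zero_of_ne_bot hker
  have horth : ∀ f ∈ degreeLT ℝ n, weightedIntegral m (P.1 * f) = 0 := fun f hf =>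
    LinearMap.congr_fun (LinearMap.mem_ker.1 hP) (⟨f, hf⟩ : degreeLT ℝ n)
  refine ⟨P, ?_, horth⟩
  have hP0' : P.1 ≠ 0 := fun h => hP0 (Subtype.ext h)
  have h1 : P.1.natDegree < n + 1 := by
    rw [natDegree_lt_iff_degree_lt hP0']; exact_mod_cast mem_degreeLT.1 P.2
  rw [degree_eq_natDegree hP0']
  by_contra hne
  have hlt : P.1.natDegree < n := by
    refine lt_of_le_of_ne (Nat.lt_succ_iff.1 h1) fun h => hne (by rw [h])
  -- A kernel element of degree below `n` would be orthogonal to itself.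
  refine hP0' (eq_zero_of_weightedIntegral_mul_self (horth _ (mem_degreeLT.2 ?_)))
  rw [degree_eq_natDegree hP0']
  exact_mod_cast hlt

/-- Integrate the derivative of `s ^ (m + 1) * P²`. The Euler operator `X P'` agrees with `n P` up
to degree below `n`, which is orthogonal to `P`, so only a multiple of the norm survives. Summing `m
+ 1 + 2 k` over `k < n` gives the constant `n (n + m)` of the next lemma. -/
theorem eval_one_sq_of_orthogonal {m n : ℕ} {P : ℝ[X]} (hP : P.degree = n)
    (h : ∀ f ∈ degreeLT ℝ n, weightedIntegral m (P * f) = 0) :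
    P.eval 1 ^ 2 = (m + 1 + 2 * n) * weightedIntegral m (P * P) := by
  have h0 : weightedIntegral m (P * (X * derivative P - (n : ℝ) • P)) = 0 := by
    apply h
    rw [mem_degreeLT, degree_lt_iff_coeff_zero]
    intro k hk
    rcases Nat.lt_or_ge n k with hk' | hk'
    · have hc : P.coeff k = 0 := coeff_eq_zero_of_degree_lt (by rw [hP]; exact_mod_cast hk')
      cases k with
      | zero => simp_all
      | succ k => simp [coeff_derivative, hc]
    · obtain rfl : k = n := le_antisymm hk' hk
      cases k with
      | zero => simp
      | succ k => simp [coeff_derivative]; ring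
  have h1 := weightedIntegral_deriv m (P * P)
  have h2 : ((m : ℝ) + 1) • (P * P) + X * derivative (P * P)
      = ((m : ℝ) + 1 + 2 * n) • (P * P) + (2 : ℝ) • (P * (X * derivative P - (n : ℝ) • P)) := by
    simp only [derivative_mul, smul_eq_C_mul, map_add, map_mul, C_1, map_ofNat]
    ring
  rw [h2, map_add, map_smul, map_smul, h0, eval_mul] at h1
  simp only [smul_eq_mul] at h1
  linarith

/-- Sharp bound for the endpoint value of a polynomial by its weighted `L²` norm. -/
theorem eval_one_sq_le (m n : ℕ) : ∀ f ∈ degreeLT ℝ n,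
    f.eval 1 ^ 2 ≤ n * (n + m) * weightedIntegral m (f * f) := by
  induction n with
  | zero =>
    intro f hf
    have : f = 0 := by
      have := mem_degreeLT.1 hf
      simpa using this
    simp [this]
  | succ n ih =>
    intro f hf
    obtain ⟨P, hP, horth⟩ := exists_orthogonal m n
    have hP0 : P ≠ 0 := by rintro rfl; simp at hP
    have hl : P.coeff n ≠ 0 := coeff_ne_zero_of_eq_degree hP
    set c := f.coeff n / P.coeff n with hc
    set g := f - c • P with hg
    have hgm : g ∈ degreeLT ℝ n := by
      rw [mem_degreeLT, degree_lt_iff_coeff_zero]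
      intro k hk
      rcases Nat.lt_or_ge n k with hk' | hk'
      · have h1 : P.coeff k = 0 := coeff_eq_zero_of_degree_lt (by rw [hP]; exact_mod_cast hk')
        have h2 : f.coeff k = 0 := coeff_eq_zero_of_degree_lt
          ((mem_degreeLT.1 hf).trans_le (by exact_mod_cast hk'))
        simp [hg, h1, h2]
      · obtain rfl : k = n := le_antisymm hk' hk
        simp [hg, hc, hl]
    have hf' : f = c • P + g := by simp [hg]
    have hff : weightedIntegral m (f * f)
        = c ^ 2 * weightedIntegral m (P * P) + weightedIntegral m (g * g) := by
      have : f * f = (c ^ 2) • (P * P) + (2 * c) • (P * g) + g * g := by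
        rw [hf']
        simp only [smul_eq_C_mul, map_mul, map_pow, map_ofNat]
        ring
      rw [this]
      simp [horth g hgm]
    have hfe : f.eval 1 = c * P.eval 1 + g.eval 1 := by rw [hf']; simp
    have h1 := eval_one_sq_of_orthogonal hP horth
    have h2 := ih g hgm
    set a := weightedIntegral m (P * P)
    set b := weightedIntegral m (g * g)
    have ha : 0 ≤ a := weightedIntegral_mul_self_nonneg m P
    have hb : 0 ≤ b := weightedIntegral_mul_self_nonneg m g
    rw [hfe, hff]
    set x := c * P.eval 1 with hx
    set y := g.eval 1
    have hx2 : x ^ 2 = (m + 1 + 2 * n) * (c ^ 2 * a) := by rw [hx, mul_pow, h1]; ring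
    set A := c ^ 2 * a
    have hA : 0 ≤ A := by positivity
    set u : ℝ := (m : ℝ) + 1 + 2 * n
    set w : ℝ := (n : ℝ) * (n + m)
    have hu : 0 < u := by positivity
    have hw : 0 ≤ w := by positivity
    have hsum : ((n + 1 : ℕ) : ℝ) * ((n + 1 : ℕ) + m) = u + w := by
      simp only [u, w]; push_cast; ring
    rw [hsum]
    -- Cauchy–Schwarz in the form `(x + y)² ≤ (u + w) (A + b)`, from `x² = u A` and `y² ≤ w b`; the
    -- cross term is handled by the arithmetic-geometric mean inequality.
    have hxy : (x * y) ^ 2 ≤ (u * b) * (w * A) := by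
      rw [mul_pow, hx2]
      calc u * A * y ^ 2 ≤ u * A * (w * b) := by gcongr
        _ = _ := by ring
    have hub : 0 ≤ u * b := by positivity
    have hwA : 0 ≤ w * A := by positivity
    have h3 : 2 * (x * y) ≤ u * b + w * A := by
      by_contra! hcon
      nlinarith [sq_nonneg (u * b - w * A)]
    nlinarith

end EndpointInequality

end

/-! ### Absorbing the consistency terms, given trace bounds. -/

noncomputable section

namespace PolyMesh

open MeasureTheory

variable {d : ℕ} (T : PolyMesh d)

@[fun_prop]
theorem continuous_val (q : MvPolynomial (Fin d) ℝ) : Continuous (val q) := by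
  unfold val
  exact (MvPolynomial.continuous_eval q).comp (by fun_prop)

@[fun_prop]
theorem continuous_grad (q : MvPolynomial (Fin d) ℝ) : Continuous (grad q) := by
  unfold grad
  exact (PiLp.continuous_toLp 2 _).comp (continuous_pi fun k => continuous_val _)

@[fun_prop]
theorem continuous_jump (v : Fin T.numCells → MvPolynomial (Fin d) ℝ)
    (e : Fin T.numCells × Fin T.numCells) : Continuous (T.jump v e) := by
  unfold jump; fun_prop

@[fun_prop]
theorem continuous_avgNormalDeriv (n : EuclideanSpace ℝ (Fin d))
    (v : Fin T.numCells → MvPolynomial (Fin d) ℝ) (e : Fin T.numCells × Fin T.numCells) :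
    Continuous (T.avgNormalDeriv n v e) := by
  unfold avgNormalDeriv; fun_prop

theorem isCompact_cell (i : Fin T.numCells) : IsCompact (T.cell i) := by
  obtain ⟨V, hV, h⟩ := T.isPolytope i
  rw [h]
  exact hV.isCompact_convexHull ℝ

theorem convex_cell (i : Fin T.numCells) : Convex ℝ (T.cell i) := by
  obtain ⟨V, hV, h⟩ := T.isPolytope i
  rw [h]
  exact convex_convexHull ℝ V

theorem isCompact_face (e : Fin T.numCells × Fin T.numCells) : IsCompact (T.face e) :=
  (T.isCompact_cell _).inter (T.isCompact_cell _)

theorem cellVol_pos (i : Fin T.numCells) : 0 < T.cellVol i :=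
  ENNReal.toReal_pos
    (Measure.measure_pos_of_nonempty_interior _ (T.interior_nonempty i)).ne'
    (T.isCompact_cell i).measure_lt_top.ne

variable {T} in
theorem mem_interiorFaces {e : Fin T.numCells × Fin T.numCells} :
    e ∈ T.interiorFaces ↔ e.1 < e.2 ∧ 0 < T.faceVol e := by
  simp [interiorFaces]

variable {T} in
theorem surf_face_ne_top {e : Fin T.numCells × Fin T.numCells} (he : e ∈ T.interiorFaces) :
    surf d (T.face e) ≠ ⊤ :=
  (ENNReal.toReal_pos_iff.1 (mem_interiorFaces.1 he).2).2.ne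

variable {T} in
theorem faceSize_pos {e : Fin T.numCells × Fin T.numCells} (he : e ∈ T.interiorFaces) :
    0 < T.faceSize e := by
  have h1 := T.cellVol_pos e.1
  have h2 := T.cellVol_pos e.2
  have h3 := (mem_interiorFaces.1 he).2
  unfold faceSize
  positivity

variable {T} in
theorem integrableOn_face {e : Fin T.numCells × Fin T.numCells} (he : e ∈ T.interiorFaces)
    {F : Type*} [NormedAddCommGroup F] {f : EuclideanSpace ℝ (Fin d) → F} (hf : Continuous f) :
    IntegrableOn f (T.face e) (surf d) :=
  hf.continuousOn.integrableOn_of_subset_isCompact (T.isCompact_face e)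
    (T.isCompact_face e).measurableSet subset_rfl (surf_face_ne_top he)

theorem harm_eq_zero_of_left {w : Fin T.numCells → ℝ} {e : Fin T.numCells × Fin T.numCells}
    (h : w e.1 = 0) : T.harm w e = 0 := by simp [harm, h]

theorem harm_eq_zero_of_right {w : Fin T.numCells → ℝ} {e : Fin T.numCells × Fin T.numCells}
    (h : w e.2 = 0) : T.harm w e = 0 := by simp [harm, h]

theorem harm_nonneg {w : Fin T.numCells → ℝ} (hw : ∀ i, 0 ≤ w i)
    (e : Fin T.numCells × Fin T.numCells) : 0 ≤ T.harm w e := by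
  have h1 := hw e.1
  have h2 := hw e.2
  unfold harm
  positivity

/-- After clearing denominators the defect is the perfect square `(w⁻ a - w⁺ b)²`. This keeps each
mobility with the derivative from its own side. -/
theorem harm_mul_sq_le {w : Fin T.numCells → ℝ} (e : Fin T.numCells × Fin T.numCells)
    (h1 : 0 < w e.1) (h2 : 0 < w e.2) (a b : ℝ) :
    T.harm w e * ((a + b) / 2) ^ 2 ≤ (w e.1 * a ^ 2 + w e.2 * b ^ 2) / 2 := by
  unfold harm
  rw [div_mul_eq_mul_div, div_le_iff₀ (by positivity)]
  nlinarith [sq_nonneg (w e.1 * a - w e.2 * b)]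

variable {T} in
/-- Young's inequality on a single face, with the consistency terms absorbed by trace bounds. -/
theorem face_integral_ge {w : Fin T.numCells → ℝ} (hw : ∀ i, 0 ≤ w i)
    {v : Fin T.numCells → MvPolynomial (Fin d) ℝ} {n : EuclideanSpace ℝ (Fin d)}
    {e : Fin T.numCells × Fin T.numCells} (he : e ∈ T.interiorFaces) {η s C : ℝ} (hs : 0 < s)
    (hη : C ≤ η - s) {τ : Fin T.numCells → ℝ} (hτ : ∀ i, 0 ≤ τ i)
    (htr : ∀ i, e.1 = i ∨ e.2 = i → 0 < w i →
      ∫ x in T.face e, inner ℝ (grad (v i) x) n ^ 2 ∂surf d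
        ≤ τ i * ∫ x in T.cell i, ‖grad (v i) x‖ ^ 2) :
    C * (∫ x in T.face e, T.harm w e / T.faceSize e * T.jump v e x ^ 2 ∂surf d)
      - T.faceSize e / (2 * s) * (w e.1 * (τ e.1 * ∫ x in T.cell e.1, ‖grad (v e.1) x‖ ^ 2)
        + w e.2 * (τ e.2 * ∫ x in T.cell e.2, ‖grad (v e.2) x‖ ^ 2))
      ≤ ∫ x in T.face e, T.harm w e * (η / T.faceSize e * T.jump v e x * T.jump v e x
        - T.avgNormalDeriv n v e x * T.jump v e x
        - T.avgNormalDeriv n v e x * T.jump v e x) ∂surf d := by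
  have hh := faceSize_pos he
  have hG : ∀ i, 0 ≤ ∫ x in T.cell i, ‖grad (v i) x‖ ^ 2 := fun i =>
    integral_nonneg fun x => by positivity
  by_cases hpos : 0 < w e.1 ∧ 0 < w e.2
  · obtain ⟨h1, h2⟩ := hpos
    set h := T.faceSize e
    have hint : ∀ f : EuclideanSpace ℝ (Fin d) → ℝ, Continuous f →
        IntegrableOn f (T.face e) (surf d) := fun f hf => integrableOn_face he hf
    have hmono : ∫ x in T.face e, (C * (T.harm w e / h * T.jump v e x ^ 2)
          - h / (2 * s) * (w e.1 * inner ℝ (grad (v e.1) x) n ^ 2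
            + w e.2 * inner ℝ (grad (v e.2) x) n ^ 2)) ∂surf d
        ≤ ∫ x in T.face e, T.harm w e * (η / h * T.jump v e x * T.jump v e x
          - T.avgNormalDeriv n v e x * T.jump v e x
          - T.avgNormalDeriv n v e x * T.jump v e x) ∂surf d := by
      refine setIntegral_mono (hint _ (by fun_prop)) (hint _ (by fun_prop)) fun x => ?_
      have hA := T.harm_mul_sq_le e h1 h2 (inner ℝ (grad (v e.1) x) n) (inner ℝ (grad (v e.2) x) n)
      have hH := T.harm_nonneg hw e
      change _ * T.avgNormalDeriv n v e x ^ 2 ≤ _ at hA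
      set A := T.avgNormalDeriv n v e x
      set j := T.jump v e x
      set H := T.harm w e
      set B := w e.1 * inner ℝ (grad (v e.1) x) n ^ 2 + w e.2 * inner ℝ (grad (v e.2) x) n ^ 2
      have hB : h / s * (H * A ^ 2) ≤ h / (2 * s) * B := by
        calc h / s * (H * A ^ 2) ≤ h / s * (B / 2) := by gcongr
          _ = _ := by field_simp
      -- Young's inequality as a completed square.
      have hsq : 0 ≤ H * (s / h * (j - h / s * A) ^ 2) := by positivity
      have hexp : H * (s / h * (j - h / s * A) ^ 2)
          = H * (s / h) * j ^ 2 - 2 * (H * (A * j)) + h / s * (H * A ^ 2) := by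
        field_simp
        ring
      have hC : C * (H / h * j ^ 2) ≤ (η - s) * (H / h * j ^ 2) := by gcongr
      have e1 : H * (η / h * j * j - A * j - A * j)
          = (η - s) * (H / h * j ^ 2) + H * (s / h) * j ^ 2 - 2 * (H * (A * j)) := by
        field_simp
        ring
      simp only
      linarith
    refine le_trans ?_ hmono
    rw [integral_sub (hint _ (by fun_prop)) (hint _ (by fun_prop)), integral_const_mul C,
      integral_const_mul (h / (2 * s)), integral_add (hint _ (by fun_prop)) (hint _ (by fun_prop)),
      integral_const_mul (w e.1), integral_const_mul (w e.2)]
    have t1 := htr e.1 (Or.inl rfl) h1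
    have t2 := htr e.2 (Or.inr rfl) h2
    gcongr
  -- On a cell of zero mobility no trace bound is assumed, but the whole face term then vanishes.
  · have hz : T.harm w e = 0 := by
      rcases not_and_or.1 hpos with h' | h'
      · exact T.harm_eq_zero_of_left (le_antisymm (not_lt.1 h') (hw _))
      · exact T.harm_eq_zero_of_right (le_antisymm (not_lt.1 h') (hw _))
    have : 0 ≤ T.faceSize e / (2 * s)
        * (w e.1 * (τ e.1 * ∫ x in T.cell e.1, ‖grad (v e.1) x‖ ^ 2)
        + w e.2 * (τ e.2 * ∫ x in T.cell e.2, ‖grad (v e.2) x‖ ^ 2)) := by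
      have := hG e.1
      have := hG e.2
      have := hw e.1
      have := hw e.2
      have := hτ e.1
      have := hτ e.2
      positivity
    simpa [hz] using this

open Classical in
variable {T} in
/-- Coercivity of the SWIP form from trace bounds with constants `τ e i`, and a splitting `s e`
of the penalty parameters that absorbs them. -/
theorem swip_ge_of_trace {w : Fin T.numCells → ℝ} (hw : ∀ i, 0 ≤ w i)
    {v : Fin T.numCells → MvPolynomial (Fin d) ℝ}
    {ν : Fin T.numCells × Fin T.numCells → EuclideanSpace ℝ (Fin d)}
    {η s : Fin T.numCells × Fin T.numCells → ℝ} {C : ℝ}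
    (hs : ∀ e ∈ T.interiorFaces, 0 < s e) (hη : ∀ e ∈ T.interiorFaces, C ≤ η e - s e)
    {τ : Fin T.numCells × Fin T.numCells → Fin T.numCells → ℝ} (hτ : ∀ e i, 0 ≤ τ e i)
    (htr : ∀ e ∈ T.interiorFaces, ∀ i, e.1 = i ∨ e.2 = i → 0 < w i →
      ∫ x in T.face e, inner ℝ (grad (v i) x) (ν e) ^ 2 ∂surf d
        ≤ τ e i * ∫ x in T.cell i, ‖grad (v i) x‖ ^ 2)
    (hsum : ∀ i, ∑ e ∈ T.interiorFaces.filter (fun e => e.1 = i ∨ e.2 = i),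
      T.faceSize e / (2 * s e) * τ e i ≤ 1 - C) :
    C * T.dgSeminormSq w v ≤ T.swip ν η w v v := by
  set G : Fin T.numCells → ℝ := fun i => ∫ x in T.cell i, ‖grad (v i) x‖ ^ 2 with hGdef
  have hG : ∀ i, 0 ≤ G i := fun i => integral_nonneg fun x => by positivity
  have hfaces := Finset.sum_le_sum fun e he =>
    face_integral_ge hw he (hs e he) (hη e he) (hτ e) (htr e he)
  rw [Finset.sum_sub_distrib, ← Finset.mul_sum] at hfaces
  have hdg : ∑ i, ∫ x in T.cell i, ‖Real.sqrt (w i) • grad (v i) x‖ ^ 2 = ∑ i, w i * G i := by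
    refine Finset.sum_congr rfl fun i _ => ?_
    rw [hGdef, ← integral_const_mul]
    congr 1; ext x
    rw [norm_smul, mul_pow, Real.norm_eq_abs, sq_abs, Real.sq_sqrt (hw i)]
  have hsw : ∑ i, ∫ x in T.cell i, w i * inner ℝ (grad (v i) x) (grad (v i) x)
      = ∑ i, w i * G i := by
    refine Finset.sum_congr rfl fun i _ => ?_
    rw [hGdef, ← integral_const_mul]
    congr 1; ext x
    rw [real_inner_self_eq_norm_sq]
  -- Regroup the face losses by cell; a face contributes to exactly its two distinct neighbours.
  have hswap : ∑ e ∈ T.interiorFaces, T.faceSize e / (2 * s e)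
        * (w e.1 * (τ e e.1 * G e.1) + w e.2 * (τ e e.2 * G e.2))
      = ∑ i, w i * G i * ∑ e ∈ T.interiorFaces.filter (fun e => e.1 = i ∨ e.2 = i),
        T.faceSize e / (2 * s e) * τ e i := by
    simp_rw [Finset.sum_filter, Finset.mul_sum]
    rw [Finset.sum_comm]
    refine Finset.sum_congr rfl fun e he => ?_
    have hne : e.1 ≠ e.2 := (mem_interiorFaces.1 he).1.ne
    rw [← Finset.sum_subset (Finset.subset_univ {e.1, e.2}), Finset.sum_pair hne]
    · simp
      ring
    · intro i _ hi
      have : ¬ (e.1 = i ∨ e.2 = i) := fun h => hi (by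
        rcases h with h | h <;> simp [h])
      simp [this]
  have hcell : ∑ i, w i * G i * ∑ e ∈ T.interiorFaces.filter (fun e => e.1 = i ∨ e.2 = i),
        T.faceSize e / (2 * s e) * τ e i ≤ ∑ i, w i * G i * (1 - C) := by
    refine Finset.sum_le_sum fun i _ => ?_
    have := hw i
    have := hG i
    have := hsum i
    gcongr
  rw [← Finset.sum_mul] at hcell
  unfold dgSeminormSq swip
  rw [hdg, hsw]
  linarith

end PolyMesh

end

/-! ### Arbitrary meshes: trace bounds by finite dimensionality. -/

noncomputable section

/-- A linear map that vanishes on the kernel of a second one is bounded by it on a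
finite-dimensional space. -/
theorem LinearMap.exists_norm_le_of_ker_le {V F G : Type*} [AddCommGroup V] [Module ℝ V]
    [FiniteDimensional ℝ V] [NormedAddCommGroup F] [NormedSpace ℝ F] [NormedAddCommGroup G]
    [NormedSpace ℝ G] (f : V →ₗ[ℝ] F) (g : V →ₗ[ℝ] G) (h : f.ker ≤ g.ker) :
    ∃ D : ℝ, 0 ≤ D ∧ ∀ v, ‖g v‖ ≤ D * ‖f v‖ := by
  obtain ⟨L, hL⟩ : ∃ L : f.range →ₗ[ℝ] G, ∀ v, L ⟨f v, f.mem_range_self v⟩ = g v := by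
    refine ⟨(f.ker.liftQ g h).comp f.quotKerEquivRange.symm.toLinearMap, fun v => ?_⟩
    have : f.quotKerEquivRange.symm ⟨f v, f.mem_range_self v⟩ = Submodule.Quotient.mk v := by
      rw [LinearEquiv.symm_apply_eq]
      exact (Subtype.ext (f.quotKerEquivRange_apply_mk v)).symm
    simp [this]
  refine ⟨‖LinearMap.toContinuousLinearMap L‖,
    (LinearMap.toContinuousLinearMap L).opNorm_nonneg, fun v => ?_⟩
  rw [← hL v]
  exact (LinearMap.toContinuousLinearMap L).le_opNorm ⟨f v, f.mem_range_self v⟩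

namespace PolyMesh

open MeasureTheory

variable {d : ℕ}

theorem grad_add (q r : MvPolynomial (Fin d) ℝ) (x : EuclideanSpace ℝ (Fin d)) :
    grad (q + r) x = grad q x + grad r x := by
  ext k; simp [grad, val]

theorem grad_smul (c : ℝ) (q : MvPolynomial (Fin d) ℝ) (x : EuclideanSpace ℝ (Fin d)) :
    grad (c • q) x = c • grad q x := by
  ext k; simp [grad, val]

variable {S : Set (EuclideanSpace ℝ (Fin d))} {μ : Measure (EuclideanSpace ℝ (Fin d))}

theorem memLp_grad (hS : IsCompact S) (hμ : μ S ≠ ⊤) (q : MvPolynomial (Fin d) ℝ) :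
    MemLp (grad q) 2 (μ.restrict S) := by
  rw [memLp_two_iff_integrable_sq_norm (continuous_grad q).aestronglyMeasurable]
  exact Continuous.continuousOn (by fun_prop) |>.integrableOn_of_subset_isCompact hS
    hS.measurableSet subset_rfl hμ

/-- The gradient as a linear map from polynomials of bounded degree to `L²` of a compact set. -/
def gradL2 (p : ℕ) (hS : IsCompact S) (hμ : μ S ≠ ⊤) :
    MvPolynomial.restrictTotalDegree (Fin d) ℝ p →ₗ[ℝ]
      Lp (EuclideanSpace ℝ (Fin d)) 2 (μ.restrict S) where
  toFun q := (memLp_grad hS hμ q.1).toLp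
  map_add' q r := by
    rw [← MemLp.toLp_add]
    exact MemLp.toLp_congr _ _ (Filter.Eventually.of_forall fun x => grad_add _ _ x)
  map_smul' c q := by
    rw [RingHom.id_apply, ← MemLp.toLp_const_smul]
    exact MemLp.toLp_congr _ _ (Filter.Eventually.of_forall fun x => grad_smul _ _ x)

theorem norm_gradL2_sq (p : ℕ) (hS : IsCompact S) (hμ : μ S ≠ ⊤)
    (q : MvPolynomial.restrictTotalDegree (Fin d) ℝ p) :
    ‖gradL2 p hS hμ q‖ ^ 2 = ∫ x in S, ‖grad q.1 x‖ ^ 2 ∂μ := by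
  rw [← real_inner_self_eq_norm_sq, L2.inner_def]
  refine integral_congr_ae ?_
  filter_upwards [(memLp_grad hS hμ q.1).coeFn_toLp] with x hx
  rw [real_inner_self_eq_norm_sq]
  exact congrArg (‖·‖ ^ 2) hx

/-- Inverse trace inequality on a convex body, with an unspecified constant. -/
theorem exists_integral_norm_grad_sq_le (p : ℕ) {K : Set (EuclideanSpace ℝ (Fin d))}
    (hK : IsCompact K) (hKc : Convex ℝ K) (hKi : (interior K).Nonempty) (hS : IsCompact S)
    (hSK : S ⊆ K) (hμ : μ S ≠ ⊤) :
    ∃ D : ℝ, 0 ≤ D ∧ ∀ q : MvPolynomial (Fin d) ℝ, q.totalDegree ≤ p →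
      ∫ x in S, ‖grad q x‖ ^ 2 ∂μ ≤ D * ∫ x in K, ‖grad q x‖ ^ 2 := by
  -- A gradient vanishing almost everywhere on `K` vanishes at every point of `K`, by continuity and
  -- since `K` lies in the closure of its interior; hence it vanishes on `S`.
  have hker : (gradL2 p hK (μ := volume) hK.measure_lt_top.ne).ker ≤ (gradL2 p hS hμ).ker := by
    intro q hq
    have hae : grad q.1 =ᵐ[volume.restrict K] 0 :=
      (memLp_grad hK hK.measure_lt_top.ne q.1).coeFn_toLp.symm.trans
        ((Lp.eq_zero_iff_ae_eq_zero).1 (LinearMap.mem_ker.1 hq))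
    have hon : Set.EqOn (grad q.1) 0 K := by
      refine Measure.eqOn_of_ae_eq hae (continuous_grad _).continuousOn continuousOn_const ?_
      rw [hKc.closure_interior_eq_closure_of_nonempty_interior hKi]
      exact subset_closure
    rw [LinearMap.mem_ker, ← norm_eq_zero, ← sq_eq_zero_iff, norm_gradL2_sq]
    rw [setIntegral_congr_fun hS.measurableSet (g := fun _ => (0 : ℝ))]
    · simp
    · intro x hx
      simp [hon (hSK hx)]
  obtain ⟨D, hD0, hD⟩ := LinearMap.exists_norm_le_of_ker_le _ _ hker
  refine ⟨D ^ 2, by positivity, fun q hq => ?_⟩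
  have h := hD ⟨q, (MvPolynomial.mem_restrictTotalDegree _ _ _).2 hq⟩
  have h2 := pow_le_pow_left₀ (norm_nonneg _) h 2
  rwa [mul_pow, norm_gradL2_sq, norm_gradL2_sq] at h2

open Classical in
/-- Coercivity on an arbitrary mesh. -/
theorem exists_coercive (T : PolyMesh d) (p : ℕ) : ∃ η₀ : ℝ, 0 < η₀ ∧ ∃ C : ℝ, 0 < C ∧
      ∀ ν, T.IsUnitNormal ν →
      ∀ η : Fin T.numCells × Fin T.numCells → ℝ, (∀ e ∈ T.interiorFaces, η₀ ≤ η e) →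
      ∀ φ ∈ T.BrokenPoly p Set.univ, ∀ v ∈ T.BrokenPoly p (T.activeCells φ),
        C * T.dgSeminormSq (T.cellMobility φ) v ≤ T.swip ν η (T.cellMobility φ) v v := by
  have hD : ∀ e i, ∃ D : ℝ, 0 ≤ D ∧ (e ∈ T.interiorFaces → (e.1 = i ∨ e.2 = i) →
      ∀ q : MvPolynomial (Fin d) ℝ, q.totalDegree ≤ p →
      ∫ x in T.face e, ‖grad q x‖ ^ 2 ∂surf d ≤ D * ∫ x in T.cell i, ‖grad q x‖ ^ 2) := by
    intro e i
    by_cases h : e ∈ T.interiorFaces ∧ (e.1 = i ∨ e.2 = i)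
    · have hsub : T.face e ⊆ T.cell i := by
        rcases h.2 with rfl | rfl
        exacts [Set.inter_subset_left, Set.inter_subset_right]
      obtain ⟨D, hD0, hD⟩ := exists_integral_norm_grad_sq_le p (T.isCompact_cell i)
        (T.convex_cell i) (T.interior_nonempty i) (T.isCompact_face e) hsub (surf_face_ne_top h.1)
      exact ⟨D, hD0, fun _ _ => hD⟩
    · exact ⟨0, le_rfl, fun h1 h2 => absurd ⟨h1, h2⟩ h⟩
  choose D hD0 hD using hD
  set S₀ := ∑ e ∈ T.interiorFaces, ∑ i, T.faceSize e * D e i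
  have hterm : ∀ e ∈ T.interiorFaces, ∀ i, 0 ≤ T.faceSize e * D e i := fun e he i =>
    mul_nonneg (faceSize_pos he).le (hD0 e i)
  have hS0 : 0 ≤ S₀ := Finset.sum_nonneg fun e he => Finset.sum_nonneg fun i _ => hterm e he i
  -- With `s = S₀ + 1` the losses per cell are at most `S₀ / (2 (S₀ + 1)) ≤ 1 / 2`, and `η - s ≥ 1 /
  -- 2` remains for the jumps. The `+ 1` keeps `s` positive when `S₀ = 0`.
  refine ⟨S₀ + 1 + 1 / 2, by positivity, 1 / 2, by norm_num, ?_⟩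
  intro ν hν η hη φ _ v hv
  refine swip_ge_of_trace (fun i => le_max_right _ _) (s := fun _ => S₀ + 1)
    (fun e _ => by positivity) (fun e he => by linarith [hη e he]) hD0 ?_ ?_
  · intro e he i hi hwi
    refine le_trans ?_ (hD e i he hi (v i) (hv i hwi))
    refine setIntegral_mono (integrableOn_face he (by fun_prop))
      (integrableOn_face he (by fun_prop)) fun x => ?_
    have := abs_real_inner_le_norm (grad (v i) x) (ν e)
    rw [(hν e he).1, mul_one] at this
    exact sq_le_sq' (abs_le.1 this).1 (abs_le.1 this).2
  · intro i
    have h1 : ∑ e ∈ T.interiorFaces.filter (fun e => e.1 = i ∨ e.2 = i),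
        T.faceSize e * D e i ≤ S₀ := by
      refine (Finset.sum_le_sum_of_subset_of_nonneg (Finset.filter_subset _ _)
        fun e he _ => hterm e he i).trans (Finset.sum_le_sum fun e he => ?_)
      exact Finset.single_le_sum (f := fun i => T.faceSize e * D e i)
        (fun j _ => hterm e he j) (Finset.mem_univ i)
    have h2 : ∑ e ∈ T.interiorFaces.filter (fun e => e.1 = i ∨ e.2 = i),
        T.faceSize e / (2 * (S₀ + 1)) * D e i
        = (∑ e ∈ T.interiorFaces.filter (fun e => e.1 = i ∨ e.2 = i),
        T.faceSize e * D e i) / (2 * (S₀ + 1)) := by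
      rw [Finset.sum_div]
      exact Finset.sum_congr rfl fun e _ => by ring
    rw [h2, div_le_iff₀ (by positivity)]
    linarith

end PolyMesh

end

/-! ### Integration over cones and the sharp trace inequality on simplices. -/

noncomputable section

open MeasureTheory

section Cone

/-- The cone of height one over `D`, with apex at the origin. -/
def unitCone {F : Type*} [NormedAddCommGroup F] [NormedSpace ℝ F] (D : Set F) : Set (ℝ × F) :=
  (fun q : ℝ × F => (q.1, q.1 • q.2)) '' (Set.Icc 0 1 ×ˢ D)

theorem isCompact_unitCone {F : Type*} [NormedAddCommGroup F] [NormedSpace ℝ F]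
    {D : Set F} (hD : IsCompact D) : IsCompact (unitCone D) :=
  (isCompact_Icc.prod hD).image (by fun_prop)

variable {F : Type*} [NormedAddCommGroup F] [NormedSpace ℝ F] [FiniteDimensional ℝ F]
  [MeasureSpace F] [BorelSpace F] [(volume : Measure F).IsAddHaarMeasure]

open scoped Pointwise in
/-- Integration over a cone along the rays through the apex. -/
theorem setIntegral_unitCone {D : Set F} (hD : IsCompact D) {g : ℝ × F → ℝ} (hg : Continuous g) :
    ∫ q in unitCone D, g q
      = ∫ z in D, ∫ s in (0 : ℝ)..1, s ^ Module.finrank ℝ F * g (s, s • z) := by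
  have hC := isCompact_unitCone hD
  -- For `0 < s ≤ 1` the slice at height `s` is `s • D`, and rescaling it to `D` produces the weight
  -- `s ^ dim F`. The height `s = 0` is a null set.
  have hslice : ∀ s : ℝ, s ≠ 0 → ∫ z, (unitCone D).indicator g (s, z)
      = (Set.Ioc (0 : ℝ) 1).indicator
        (fun s => ∫ z in D, s ^ Module.finrank ℝ F * g (s, s • z)) s := by
    intro s hs
    by_cases hs1 : s ∈ Set.Ioc (0 : ℝ) 1
    · rw [Set.indicator_of_mem hs1, integral_const_mul,
        Measure.setIntegral_comp_smul_of_pos volume (fun z => g (s, z)) D hs1.1, smul_eq_mul,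
        ← mul_assoc, mul_inv_cancel₀ (pow_ne_zero _ hs), one_mul,
        ← integral_indicator (hD.smul s).measurableSet]
      congr 1; ext z
      have : (s, z) ∈ unitCone D ↔ z ∈ s • D := by
        simp only [unitCone, Set.mem_image, Set.mem_prod, Prod.exists, Prod.mk.injEq,
          Set.mem_smul_set]
        constructor
        · rintro ⟨a, b, ⟨_, hb⟩, rfl, rfl⟩
          exact ⟨b, hb, rfl⟩
        · rintro ⟨b, hb, rfl⟩
          exact ⟨s, b, ⟨⟨hs1.1.le, hs1.2⟩, hb⟩, rfl, rfl⟩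
      by_cases hz : z ∈ s • D
      · rw [Set.indicator_of_mem hz, Set.indicator_of_mem (this.2 hz)]
      · rw [Set.indicator_of_notMem hz, Set.indicator_of_notMem (fun h => hz (this.1 h))]
    · rw [Set.indicator_of_notMem hs1]
      refine integral_eq_zero_of_ae (Filter.Eventually.of_forall fun z => ?_)
      refine Set.indicator_of_notMem (fun h => hs1 ?_) _
      obtain ⟨q, hq, hqz⟩ := h
      obtain ⟨rfl, -⟩ := Prod.mk.inj hqz
      exact ⟨lt_of_le_of_ne hq.1.1 hs.symm, hq.1.2⟩
  rw [← integral_indicator hC.measurableSet, Measure.volume_eq_prod,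
    integral_prod _ ((integrable_indicator_iff hC.measurableSet).2
      (hg.continuousOn.integrableOn_compact hC))]
  have hae : ∀ᵐ s : ℝ, s ≠ 0 := by
    simp [ae_iff]
  rw [integral_congr_ae (hae.mono hslice), integral_indicator measurableSet_Ioc]
  simp_rw [intervalIntegral.integral_of_le zero_le_one]
  refine integral_integral_swap ?_
  rw [Measure.prod_restrict]
  refine IntegrableOn.mono_set ?_ (Set.prod_mono_left Set.Ioc_subset_Icc_self)
  refine Continuous.continuousOn ?_ |>.integrableOn_compact (isCompact_Icc.prod hD)
  simp only [Function.uncurry_def]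
  fun_prop

/-- Sharp bound on the base of a cone for functions that are polynomials of degree less than `p`
on lines. -/
theorem setIntegral_base_sq_le {D : Set F} (hD : IsCompact D) {f : ℝ × F → ℝ} (hf : Continuous f)
    {p : ℕ} (hpoly : ∀ z, ∃ g ∈ Polynomial.degreeLT ℝ p, ∀ s : ℝ, f (s, s • z) = g.eval s) :
    ∫ z in D, f (1, z) ^ 2
      ≤ p * (p + Module.finrank ℝ F) * ∫ q in unitCone D, f q ^ 2 := by
  rw [setIntegral_unitCone hD (by fun_prop), ← integral_const_mul]
  refine setIntegral_mono ?_ ?_ fun z => ?_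
  · exact Continuous.continuousOn (by fun_prop) |>.integrableOn_compact hD
  · refine Continuous.continuousOn ?_ |>.integrableOn_compact hD
    refine continuous_const.mul
      (intervalIntegral.continuous_parametric_intervalIntegral_of_continuous' ?_ 0 1)
    simp only [Function.uncurry_def]
    fun_prop
  · obtain ⟨g, hg, hgs⟩ := hpoly z
    have h := EndpointInequality.eval_one_sq_le (Module.finrank ℝ F) p g hg
    rw [EndpointInequality.weightedIntegral_apply] at h
    have h1 := hgs 1
    rw [one_smul] at h1
    simp only [hgs, h1, pow_two (Polynomial.eval _ g)]
    simpa only [Polynomial.eval_mul, pow_two (Polynomial.eval 1 g)] using h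

theorem volume_unitCone {D : Set F} (hD : IsCompact D) :
    volume.real (unitCone D) = volume.real D / (Module.finrank ℝ F + 1) := by
  have h := setIntegral_unitCone hD (g := fun _ => 1) continuous_const
  have h2 : ∫ s in (0 : ℝ)..1, s ^ Module.finrank ℝ F = 1 / (Module.finrank ℝ F + 1) := by
    simp [integral_pow]
  simp only [mul_one, h2, setIntegral_const, smul_eq_mul] at h
  rw [h]; ring

end Cone

section Simplex

variable {m : ℕ}

/-- Coordinates in which a facet of a simplex is isometrically parametrized and the apex is the
origin. -/
theorem exists_facet_coordinates {P : Fin (m + 2) → EuclideanSpace ℝ (Fin (m + 1))}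
    (hP : AffineIndependent ℝ P) (k : Fin (m + 2)) :
    ∃ (ι : EuclideanSpace ℝ (Fin m) →ₗᵢ[ℝ] EuclideanSpace ℝ (Fin (m + 1)))
      (u : EuclideanSpace ℝ (Fin (m + 1))),
      (convexHull ℝ (P '' {k}ᶜ) ⊆ Set.range fun z => P k + (u + ι z)) ∧
      ∀ (s : ℝ) z, s • u + ι z = 0 → s = 0 ∧ z = 0 := by
  set S := P '' {k}ᶜ with hS
  have hrange : Set.range (P ∘ k.succAbove) = S := by
    rw [Set.range_comp, Fin.range_succAbove]
  have hfin : Module.finrank ℝ (vectorSpan ℝ S) = m := by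
    rw [← hrange]
    exact (hP.comp_embedding k.succAboveEmb).finrank_vectorSpan (Fintype.card_fin _)
  let b := (stdOrthonormalBasis ℝ (vectorSpan ℝ S)).reindex (finCongr hfin)
  let ι : EuclideanSpace ℝ (Fin m) →ₗᵢ[ℝ] EuclideanSpace ℝ (Fin (m + 1)) :=
    (vectorSpan ℝ S).subtypeₗᵢ.comp b.repr.symm.toLinearIsometry
  have hι : ∀ z, ι z ∈ vectorSpan ℝ S := fun z => (b.repr.symm z).2
  have hι' : ∀ w ∈ vectorSpan ℝ S, ∃ z, ι z = w := fun w hw =>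
    ⟨b.repr ⟨w, hw⟩, by simp [ι]⟩
  set j := k.succAbove 0
  have hj : P j ∈ S := ⟨j, k.succAbove_ne 0, rfl⟩
  have hk : P k ∉ affineSpan ℝ S := by
    have := hP.notMem_affineSpan_sdiff k Set.univ
    rwa [← Set.compl_eq_univ_sdiff] at this
  have hu : P j - P k ∉ vectorSpan ℝ S := fun h => hk (by
    have h2 := AffineSubspace.vadd_mem_of_mem_direction
      (direction_affineSpan ℝ S ▸ (vectorSpan ℝ S).neg_mem h) (subset_affineSpan ℝ S hj)
    simpa using h2)
  refine ⟨ι, P j - P k, fun x hx => ?_, fun s z h => ?_⟩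
  · obtain ⟨z, hz⟩ := hι' (x - P j)
      (vsub_mem_vectorSpan_of_mem_affineSpan_of_mem_affineSpan
        (convexHull_subset_affineSpan S hx) (subset_affineSpan ℝ S hj))
    exact ⟨z, by simp [hz]⟩
  · have hs : s = 0 := by
      by_contra hs
      refine hu ?_
      have : P j - P k = -(s⁻¹ • ι z) := by
        rw [eq_neg_iff_add_eq_zero,
          ← smul_right_injective (EuclideanSpace ℝ (Fin (m + 1))) hs |>.eq_iff]
        simp [smul_smul, hs, h]
      rw [this]
      exact (vectorSpan ℝ S).neg_mem ((vectorSpan ℝ S).smul_mem _ (hι z))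
    subst hs
    refine ⟨rfl, ?_⟩
    rw [zero_smul, zero_add] at h
    exact ι.injective (by rw [h, map_zero])

/-- Sharp inverse trace inequality on a simplex. -/
theorem setIntegral_facet_sq_le {P : Fin (m + 2) → EuclideanSpace ℝ (Fin (m + 1))}
    (hP : AffineIndependent ℝ P) (k : Fin (m + 2))
    {f : EuclideanSpace ℝ (Fin (m + 1)) → ℝ} (hf : Continuous f) {p : ℕ}
    (hpoly : ∀ a b : EuclideanSpace ℝ (Fin (m + 1)),
      ∃ g ∈ Polynomial.degreeLT ℝ p, ∀ s : ℝ, f (a + s • b) = g.eval s) :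
    ∫ x in convexHull ℝ (P '' {k}ᶜ), f x ^ 2 ∂μHE[m]
      ≤ p * (p + m) / (m + 1) * ((μHE[m]).real (convexHull ℝ (P '' {k}ᶜ))
        / volume.real (convexHull ℝ (Set.range P)))
        * ∫ x in convexHull ℝ (Set.range P), f x ^ 2 := by
  obtain ⟨ι, u, hrange, hinj⟩ := exists_facet_coordinates hP k
  set e := convexHull ℝ (P '' {k}ᶜ) with he
  set K := convexHull ℝ (Set.range P) with hK
  have hec : IsCompact e := ((Set.toFinite {k}ᶜ).image P).isCompact_convexHull ℝ
  have hKc : IsCompact K := (Set.finite_range P).isCompact_convexHull ℝ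
  have hKi : (interior K).Nonempty := by
    rw [interior_convexHull_nonempty_iff_affineSpan_eq_top,
      hP.affineSpan_eq_top_iff_card_eq_finrank_add_one]
    simp
  have hKvol : 0 < volume.real K := ENNReal.toReal_pos
    (Measure.measure_pos_of_nonempty_interior _ hKi).ne' hKc.measure_lt_top.ne
  let φ : EuclideanSpace ℝ (Fin m) → EuclideanSpace ℝ (Fin (m + 1)) := fun z => P k + (u + ι z)
  have hφ : Isometry φ := by
    refine Isometry.of_dist_eq fun x y => ?_
    simp [φ, ι.isometry.dist_eq]
  have hφe : MeasurableEmbedding φ := hφ.isClosedEmbedding.measurableEmbedding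
  set D := φ ⁻¹' e with hDdef
  have hD : IsCompact D := hφ.isClosedEmbedding.isCompact_preimage hec
  -- Isometries preserve Hausdorff measure, so the surface measure on the facet's hyperplane is
  -- Lebesgue measure in the coordinate `z`.
  have hφμ : (volume : Measure (EuclideanSpace ℝ (Fin m))).map φ
      = (μHE[m] : Measure (EuclideanSpace ℝ (Fin (m + 1)))).restrict (Set.range φ) := by
    rw [← EuclideanSpace.euclideanHausdorffMeasure_eq_volume, hφ.map_euclideanHausdorffMeasure]
  have hφr : ((μHE[m] : Measure (EuclideanSpace ℝ (Fin (m + 1)))).restrict (Set.range φ)).restrict e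
      = (μHE[m] : Measure (EuclideanSpace ℝ (Fin (m + 1)))).restrict e := by
    rw [Measure.restrict_restrict hec.measurableSet, Set.inter_eq_left.2 hrange]
  have hface : ∀ g : EuclideanSpace ℝ (Fin (m + 1)) → ℝ,
      ∫ x in e, g x ∂μHE[m] = ∫ z in D, g (φ z) := fun g => by
    rw [← hφr, ← hφμ, hφe.setIntegral_map]
  let L₀ : (ℝ × EuclideanSpace ℝ (Fin m)) →ₗ[ℝ] EuclideanSpace ℝ (Fin (m + 1)) :=
    (LinearMap.toSpanSingleton ℝ (EuclideanSpace ℝ (Fin (m + 1))) u).coprod ι.toLinearMap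
  have hL₀ : Function.Injective L₀ := by
    rw [injective_iff_map_eq_zero]
    rintro ⟨s, z⟩ h
    obtain ⟨rfl, rfl⟩ := hinj s z (by simpa [L₀] using h)
    rfl
  let L : (ℝ × EuclideanSpace ℝ (Fin m)) ≃L[ℝ] EuclideanSpace ℝ (Fin (m + 1)) :=
    (L₀.linearEquivOfInjective hL₀ (by simp [add_comm])).toContinuousLinearEquiv
  have hL : ∀ s z, L (s, z) = s • u + ι z := fun s z => by simp [L, L₀]
  let Φ : (ℝ × EuclideanSpace ℝ (Fin m)) ≃ₜ EuclideanSpace ℝ (Fin (m + 1)) :=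
    L.toHomeomorph.trans (Homeomorph.addLeft (P k))
  have hΦ : ∀ s z, Φ (s, z) = P k + (s • u + ι z) := fun s z => by simp [Φ, hL]
  -- The Jacobian exists by uniqueness of Haar measure; no determinant is computed, and `hvol` finds
  -- its value by integrating the constant `1`.
  obtain ⟨c, hc⟩ : ∃ c : NNReal,
      (volume : Measure (ℝ × EuclideanSpace ℝ (Fin m))).map Φ
        = c • (volume : Measure (EuclideanSpace ℝ (Fin (m + 1)))) := by
    have h1 : (volume : Measure (ℝ × EuclideanSpace ℝ (Fin m))).map Φ
        = ((volume : Measure (ℝ × EuclideanSpace ℝ (Fin m))).map L).map (P k + ·) := by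
      rw [Measure.map_map (by fun_prop) (by fun_prop)]
      rfl
    have h0 : (volume : Measure (ℝ × EuclideanSpace ℝ (Fin m))).IsAddHaarMeasure :=
      inferInstanceAs (Measure.prod volume volume).IsAddHaarMeasure
    have h2 := L.isAddHaarMeasure_map (volume : Measure (ℝ × EuclideanSpace ℝ (Fin m)))
    rw [h1, map_add_left_eq_self]
    exact ⟨_, Measure.isAddLeftInvariant_eq_smul _ _⟩
  -- The simplex is the join of its apex with the opposite facet, which in these coordinates is the
  -- unit cone.
  have hpre : Φ ⁻¹' K = unitCone D := by
    have hKe : K = convexJoin ℝ {P k} e := by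
      rw [he, ← convexHull_insert]
      · rw [hK, ← Set.image_insert_eq, Set.insert_eq, Set.union_compl_self, Set.image_univ]
      · exact ⟨_, k.succAbove 0, k.succAbove_ne 0, rfl⟩
    ext ⟨s, z⟩
    rw [Set.mem_preimage, hKe, mem_convexJoin]
    simp only [Set.mem_singleton_iff, exists_eq_left, segment_eq_image', Set.mem_image, unitCone,
      Set.mem_prod, Prod.exists, Prod.mk.injEq]
    constructor
    · rintro ⟨y, hy, t, ht, hty⟩
      obtain ⟨z', rfl⟩ := hrange hy
      have : Φ (t, t • z') = Φ (s, z) := by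
        rw [← hty, hΦ]; simp [smul_add]
      obtain ⟨h1, h2⟩ := Prod.mk.inj (Φ.injective this)
      exact ⟨t, z', ⟨ht, hy⟩, h1, h2⟩
    · rintro ⟨t, z', ⟨ht, hz'⟩, rfl, rfl⟩
      exact ⟨φ z', hz', t, ht, by rw [hΦ]; simp [φ, smul_add]⟩
  have hcell : ∀ g : EuclideanSpace ℝ (Fin (m + 1)) → ℝ,
      c * ∫ x in K, g x = ∫ q in unitCone D, g (Φ q) := fun g => by
    rw [← hpre, ← Φ.measurableEmbedding.setIntegral_map, hc, Measure.restrict_smul,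
      integral_smul_nnreal_measure]
    rfl
  have hvol : c * volume.real K = (μHE[m]).real e / (m + 1) := by
    have h1 := hcell fun _ => 1
    have h2 := hface fun _ => 1
    have h3 := volume_unitCone hD
    simp only [setIntegral_const, smul_eq_mul, mul_one] at h1 h2
    rw [h1, h2, h3]
    simp
  have hc' : (c : ℝ) = (μHE[m]).real e / volume.real K / (m + 1) := by
    rw [eq_div_iff (by positivity)] at hvol
    field_simp
    linarith
  have hmain := setIntegral_base_sq_le hD (f := fun q => f (Φ q)) (by fun_prop) (p := p)
    fun z => by
      obtain ⟨g, hg, hgs⟩ := hpoly (P k) (u + ι z)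
      refine ⟨g, hg, fun s => ?_⟩
      rw [← hgs, hΦ]
      simp [smul_add]
  rw [← hcell fun x => f x ^ 2] at hmain
  rw [hface]
  have hφΦ : ∀ z, φ z = Φ (1, z) := fun z => by simp [φ, hΦ]
  simp only [hφΦ]
  refine hmain.trans (le_of_eq ?_)
  rw [hc', finrank_euclideanSpace, Fintype.card_fin]
  ring

end Simplex

end

/-! ### Polynomials on lines and the explicit penalty threshold. -/

noncomputable section

namespace PolyMesh

open MeasureTheory

section Line

open Polynomial

variable {d : ℕ}

/-- The restriction of a multivariate polynomial to the line `s ↦ a + s • b`. -/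
def lineRestriction (a b : EuclideanSpace ℝ (Fin d)) : MvPolynomial (Fin d) ℝ →ₐ[ℝ] ℝ[X] :=
  MvPolynomial.aeval fun k => C (a k) + C (b k) * X

theorem eval_lineRestriction (a b : EuclideanSpace ℝ (Fin d)) (q : MvPolynomial (Fin d) ℝ)
    (s : ℝ) : (lineRestriction a b q).eval s = val q (a + s • b) := by
  have h : (Polynomial.aeval s).comp (lineRestriction a b)
      = MvPolynomial.aeval fun k => (a + s • b) k := by
    refine MvPolynomial.algHom_ext fun k => ?_
    simp [lineRestriction, mul_comm s]
  simpa [val, MvPolynomial.aeval_eq_eval] using DFunLike.congr_fun h q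

theorem lineRestriction_pderiv_mem_degreeLT (a b : EuclideanSpace ℝ (Fin d)) (k : Fin d) {p : ℕ}
    {q : MvPolynomial (Fin d) ℝ} (hq : q.totalDegree ≤ p) :
    lineRestriction a b (MvPolynomial.pderiv k q) ∈ degreeLT ℝ p := by
  rw [q.as_sum, map_sum, map_sum]
  refine Submodule.sum_mem _ fun t ht => ?_
  rw [MvPolynomial.pderiv_monomial]
  -- Here the derivative of the monomial is zero; it is split off because the truncated `t -
  -- Finsupp.single k 1` would not lower the degree.
  by_cases htk : t k = 0
  · simp [htk]
  have hdeg : (t - Finsupp.single k 1).degree + 1 ≤ p := by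
    have h1 : (t - Finsupp.single k 1) + Finsupp.single k 1 = t :=
      tsub_add_cancel_of_le (by simpa [Nat.one_le_iff_ne_zero] using htk)
    have h2 : t.degree ≤ p := (MvPolynomial.le_totalDegree ht).trans hq
    rw [← h1, map_add, Finsupp.degree_single] at h2
    exact h2
  have h3 := MvPolynomial.aeval_natDegree_le (n := 1)
    (MvPolynomial.monomial (t - Finsupp.single k 1) (MvPolynomial.coeff t q * t k))
    (MvPolynomial.totalDegree_monomial_le _ _) (fun k => C (a k) + C (b k) * X)
    (fun k => by compute_degree)
  rw [mul_one] at h3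
  rw [mem_degreeLT]
  refine degree_le_natDegree.trans_lt ?_
  have h4 : (t - Finsupp.single k 1).sum (fun _ => id) = (t - Finsupp.single k 1).degree := rfl
  exact_mod_cast (h3.trans_lt (by omega) : _ < p)

/-- For a fixed direction `n` this is a constant combination of partial derivatives, so its degree
on every line is below `p`: the hypothesis of the simplex trace inequality. -/
theorem exists_lineRestriction_inner_grad (n a b : EuclideanSpace ℝ (Fin d)) {p : ℕ}
    {q : MvPolynomial (Fin d) ℝ} (hq : q.totalDegree ≤ p) :
    ∃ g ∈ degreeLT ℝ p, ∀ s : ℝ, inner ℝ (grad q (a + s • b)) n = g.eval s := by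
  refine ⟨∑ k, n k • lineRestriction a b (MvPolynomial.pderiv k q),
    Submodule.sum_mem _ fun k _ => Submodule.smul_mem _ _
      (lineRestriction_pderiv_mem_degreeLT a b k hq), fun s => ?_⟩
  simp [PiLp.inner_apply, Polynomial.eval_finsetSum, eval_lineRestriction, grad]

end Line

/-- Sharp inverse trace inequality for normal derivatives on simplicial meshes. -/
theorem IsConformingSimplicial.trace {d : ℕ} (hd : 1 ≤ d) {T : PolyMesh d}
    (hT : T.IsConformingSimplicial) {e : Fin T.numCells × Fin T.numCells}
    (he : e ∈ T.interiorFaces) {i : Fin T.numCells} (hi : e.1 = i ∨ e.2 = i) {p : ℕ}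
    {q : MvPolynomial (Fin d) ℝ} (hq : q.totalDegree ≤ p) {n : EuclideanSpace ℝ (Fin d)}
    (hn : ‖n‖ = 1) :
    ∫ x in T.face e, inner ℝ (grad q x) n ^ 2 ∂surf d
      ≤ traceConst d p * (T.faceVol e / T.cellVol i) * ∫ x in T.cell i, ‖grad q x‖ ^ 2 := by
  obtain ⟨m, rfl⟩ : ∃ m, d = m + 1 := ⟨d - 1, by omega⟩
  obtain ⟨P, hP, hcell, hface⟩ := hT i
  obtain ⟨k, hk⟩ := hface e he hi
  have h := setIntegral_facet_sq_le hP k (f := fun x => inner ℝ (grad q x) n) (by fun_prop)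
    (fun a b => exists_lineRestriction_inner_grad n a b hq)
  rw [← hk, ← hcell] at h
  have hC : traceConst (m + 1) p = p * (p + m) / (m + 1) := by
    simp only [traceConst, Nat.cast_add, Nat.cast_one]
    ring
  rw [hC]
  refine h.trans ?_
  have hmono : ∫ x in T.cell i, inner ℝ (grad q x) n ^ 2 ≤ ∫ x in T.cell i, ‖grad q x‖ ^ 2 := by
    refine setIntegral_mono
      ((Continuous.continuousOn (by fun_prop)).integrableOn_compact (T.isCompact_cell i))
      ((Continuous.continuousOn (by fun_prop)).integrableOn_compact (T.isCompact_cell i))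
      fun x => ?_
    have := abs_real_inner_le_norm (grad q x) n
    rw [hn, mul_one] at this
    exact sq_le_sq' (abs_le.1 this).1 (abs_le.1 this).2
  exact mul_le_mul_of_nonneg_left hmono (by positivity)

theorem traceConst_nonneg {d : ℕ} (hd : 1 ≤ d) (p : ℕ) : 0 ≤ traceConst d p := by
  have : (1 : ℝ) ≤ d := by exact_mod_cast hd
  unfold traceConst
  have : (0 : ℝ) ≤ p + d - 1 := by linarith [(Nat.cast_nonneg p : (0 : ℝ) ≤ p)]
  positivity

open Classical in
/-- Coercivity on conforming simplicial meshes, with the explicit penalty threshold. -/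
theorem exists_coercive_simplicial {d : ℕ} (hd : 1 ≤ d) (p : ℕ) (σ η₀ : ℝ) (hη₀ : 0 < η₀) :
    ∃ C : ℝ, 0 < C ∧
      ∀ T : PolyMesh d, T.IsConformingSimplicial →
      (∀ e ∈ T.interiorFaces,
        T.cellVol e.1 ≤ σ * T.cellVol e.2 ∧ T.cellVol e.2 ≤ σ * T.cellVol e.1) →
      ∀ ν, T.IsUnitNormal ν →
      ∀ η : Fin T.numCells × Fin T.numCells → ℝ,
      (∀ e ∈ T.interiorFaces, η₀ ≤ η e ∧
        (T.numFaces e.1 : ℝ) * traceConst d p ≤ η e ∧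
        (T.numFaces e.2 : ℝ) * traceConst d p ≤ η e) →
      ∀ φ ∈ T.BrokenPoly p Set.univ, ∀ v ∈ T.BrokenPoly p (T.activeCells φ),
        C * T.dgSeminormSq (T.cellMobility φ) v ≤ T.swip ν η (T.cellMobility φ) v v := by
  -- No sign of `σ` is assumed, and without interior faces it is arbitrary; the maximum makes `r`
  -- positive.
  set r : ℝ := max σ 1
  have hr : 1 ≤ r := le_max_right _ _
  have hσr : σ ≤ r := le_max_left _ _
  -- Lies strictly between the largest volume fraction `r / (r + 1)` and `1`: taking `s = lam * η`
  -- leaves room both in the cell budget and in the penalty.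
  set lam : ℝ := (2 * r + 1) / (2 * r + 2) with hlam
  have hlam0 : 0 < lam := by positivity
  set C : ℝ := min 1 η₀ / (2 * r + 2) with hC
  have hC1 : C ≤ 1 / (2 * r + 2) := by
    rw [hC]; gcongr; exact min_le_left _ _
  have hC2 : C ≤ η₀ / (2 * r + 2) := by
    rw [hC]; gcongr; exact min_le_right _ _
  have h1lam : 1 - lam = 1 / (2 * r + 2) := by
    rw [hlam]; field_simp; ring
  have hCT := traceConst_nonneg hd p
  refine ⟨C, by positivity, fun T hT hvol ν hν η hη φ _ v hv => ?_⟩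
  have hη0 : ∀ e ∈ T.interiorFaces, 0 < η e := fun e he => hη₀.trans_le (hη e he).1
  refine swip_ge_of_trace (fun i => le_max_right _ _) (s := fun e => lam * η e)
    (τ := fun e i => traceConst d p * (T.faceVol e / T.cellVol i))
    (fun e he => mul_pos hlam0 (hη0 e he)) (fun e he => ?_) (fun e i => ?_) ?_ ?_
  · calc C ≤ η₀ / (2 * r + 2) := hC2
      _ ≤ η e / (2 * r + 2) := by gcongr; exact (hη e he).1
      _ = (1 - lam) * η e := by rw [h1lam]; ring
      _ = _ := by ring
  · have := T.cellVol_pos i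
    have : 0 ≤ T.faceVol e := measureReal_nonneg
    positivity
  · intro e he i hi hwi
    exact hT.trace hd he hi (hv i hwi) (hν e he).1
  · intro i
    set S := T.interiorFaces.filter fun e => e.1 = i ∨ e.2 = i with hS
    set M : ℝ := (T.numFaces i : ℝ)
    have hM : (S.card : ℝ) = M := rfl
    have hterm : ∀ e ∈ S, T.faceSize e / (2 * (lam * η e))
        * (traceConst d p * (T.faceVol e / T.cellVol i))
        ≤ 2 * r / (2 * r + 1) * M⁻¹ := by
      intro e heS
      obtain ⟨he, hi⟩ := Finset.mem_filter.1 heS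
      have hM0 : 0 < M := by
        rw [← hM]; exact_mod_cast Finset.card_pos.2 ⟨e, heS⟩
      have hηM : M * traceConst d p ≤ η e := by
        rcases hi with rfl | rfl
        exacts [(hη e he).2.1, (hη e he).2.2]
      have hf := (mem_interiorFaces.1 he).2
      have hv1 := T.cellVol_pos e.1
      have hv2 := T.cellVol_pos e.2
      have hηe := hη0 e he
      -- The face measure cancels, leaving twice the neighbour's share of the joint volume.
      have hθ : T.faceSize e * (T.faceVol e / T.cellVol i) ≤ 2 * (r / (r + 1)) := by
        obtain ⟨ha, hb⟩ := hvol e he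
        have ha' : T.cellVol e.1 ≤ r * T.cellVol e.2 := ha.trans (by gcongr)
        have hb' : T.cellVol e.2 ≤ r * T.cellVol e.1 := hb.trans (by gcongr)
        rcases hi with rfl | rfl
        · have : T.faceSize e * (T.faceVol e / T.cellVol e.1)
              = 2 * (T.cellVol e.2 / (T.cellVol e.1 + T.cellVol e.2)) := by
            unfold faceSize; field_simp
          rw [this]
          gcongr 2 * ?_
          rw [div_le_div_iff₀ (by positivity) (by positivity)]
          linarith
        · have : T.faceSize e * (T.faceVol e / T.cellVol e.2)
              = 2 * (T.cellVol e.1 / (T.cellVol e.1 + T.cellVol e.2)) := by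
            unfold faceSize; field_simp
          rw [this]
          gcongr 2 * ?_
          rw [div_le_div_iff₀ (by positivity) (by positivity)]
          linarith
      have hq : traceConst d p / η e ≤ M⁻¹ := by
        rw [div_le_iff₀ hηe, inv_mul_eq_div, le_div_iff₀ hM0]
        linarith
      calc T.faceSize e / (2 * (lam * η e)) * (traceConst d p * (T.faceVol e / T.cellVol i))
          = T.faceSize e * (T.faceVol e / T.cellVol i) * (1 / (2 * lam))
            * (traceConst d p / η e) := by field_simp
        _ ≤ 2 * (r / (r + 1)) * (1 / (2 * lam)) * M⁻¹ := by gcongr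
        _ = 2 * r / (2 * r + 1) * M⁻¹ := by rw [hlam]; field_simp
    calc _ ≤ ∑ e ∈ S, 2 * r / (2 * r + 1) * M⁻¹ := Finset.sum_le_sum hterm
      _ = 2 * r / (2 * r + 1) * (M * M⁻¹) := by
        rw [Finset.sum_const, nsmul_eq_mul, hM]; ring
      _ ≤ 2 * r / (2 * r + 1) * 1 := by
        gcongr
        -- Also covers a cell without interior faces, where `M = 0` and `M⁻¹ = 0`.
        exact mul_inv_le_one
      _ = 1 - 1 / (2 * r + 1) := by field_simp; ring
      _ ≤ 1 - 1 / (2 * r + 2) := by gcongr; norm_num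
      _ ≤ 1 - C := by linarith

end PolyMesh

end

theorem theorem2 (d : ℕ) (hd : 1 ≤ d) (p : ℕ) :
    -- every mesh: threshold and coercivity constant depend on the mesh and on `p` only
    (∀ T : PolyMesh d, ∃ η₀ : ℝ, 0 < η₀ ∧ ∃ C : ℝ, 0 < C ∧
      ∀ ν, T.IsUnitNormal ν →
      ∀ η : Fin T.numCells × Fin T.numCells → ℝ, (∀ e ∈ T.interiorFaces, η₀ ≤ η e) →
      ∀ φ ∈ T.BrokenPoly p Set.univ, ∀ v ∈ T.BrokenPoly p (T.activeCells φ),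
        C * T.dgSeminormSq (T.cellMobility φ) v ≤ T.swip ν η (T.cellMobility φ) v v) ∧
    -- conforming simplicial meshes: the explicit threshold `η_e ≥ m_K C_T`, with a coercivity
    -- constant depending only on `d`, `p`, a bound for the volume ratio of neighbouring
    -- cells, and a positive lower bound for `η`
    (∀ σ η₀ : ℝ, 0 < η₀ → ∃ C : ℝ, 0 < C ∧
      ∀ T : PolyMesh d, T.IsConformingSimplicial →
      (∀ e ∈ T.interiorFaces,
        T.cellVol e.1 ≤ σ * T.cellVol e.2 ∧ T.cellVol e.2 ≤ σ * T.cellVol e.1) →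
      ∀ ν, T.IsUnitNormal ν →
      ∀ η : Fin T.numCells × Fin T.numCells → ℝ,
      (∀ e ∈ T.interiorFaces, η₀ ≤ η e ∧
        (T.numFaces e.1 : ℝ) * traceConst d p ≤ η e ∧
        (T.numFaces e.2 : ℝ) * traceConst d p ≤ η e) →
      ∀ φ ∈ T.BrokenPoly p Set.univ, ∀ v ∈ T.BrokenPoly p (T.activeCells φ),
        C * T.dgSeminormSq (T.cellMobility φ) v ≤ T.swip ν η (T.cellMobility φ) v v) := by
  exact ⟨fun T => PolyMesh.exists_coercive T p,
    fun σ η₀ hη₀ => PolyMesh.exists_coercive_simplicial hd p σ η₀ hη₀⟩
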